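/- Let $\mathbb T=\mathbb R/\mathbb Z$ and let $f:\mathbb T\to[0,+\infty]$ be even and continuous (as a map into $[0,+\infty]$), with $f(t)<\infty$ for $t\neq 0$; thus $f$ is either finite and continuous on $\mathbb T$, or singular at $0$ with $f(0)=\lim_{t\to0}f(t)=+\infty$. View $f$ also as a $1$-periodic function on $\mathbb R$. For a multiset $X=\{\mathbf x^0,\dots,\mathbf x^{3}\}$ of four points of $\mathbb T^2$, $\mathbf x^k=(x^k_1,x^k_2)$, define the tensor product energy $$E_F(X)=\sum_{\substack{k,\ell=0\\ k\ne \ell}}^{3} f(x_1^k-x_1^\ell)\,f(x_2^k-x_2^\ell).$$ Suppose that $f$ is differentiable on $(0,1)$, and that on $(0,1/2]$ it is (weakly) decreasing and logarithmically convex, i.e. $f>0$ and $\log f$ is convex there. For $a\in(0,1/2)$ let $$X_a=\{(0,0),\ (a,1/2),\ (1/2,a),\ (1/2+a,1/2+a)\}\subset\mathbb T^2 .$$ Then: 1. There exists $a\in(0,1/2)$ such that $X_a$ is a global minimizer of $E_F$ among all four-point configurations (multisets) in $\mathbb T^2$. 2. Every $a\in(0,1/2)$ for which $X_a$ is such a minimizer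 satisfies $$f'(a)\,f(1/2)=f'(1/2-a)\,f(1/2-a).\qquad(*)$$ 3. If moreover $\log f$ is strictly convex on $(0,1/2]$, then there is exactly one $a\in(0,1/2)$ for which $X_a$ is a global minimizer of $E_F$, and exactly one $a\in(0,1/2)$ satisfying $(*)$. -/

import Mathlib

open scoped ENNReal

/-- A one-dimensional potential on the circle `𝕋 = ℝ/ℤ`: a nonnegative, even, continuous function.
The value `+∞` is allowed at the point `0` only; continuity (as a map into `[0, +∞]`) then says
that `f` is either an ordinary continuous function on `𝕋`, or is finite and continuous off `0` with
`f(t) → +∞ = f(0)` as `t → 0`. -/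
structure TorusPotential where
  toFun : UnitAddCircle → ℝ≥0∞
  even' : ∀ t, toFun (-t) = toFun t
  continuous' : Continuous toFun
  finite' : ∀ t, t ≠ 0 → toFun t ≠ ∞

namespace TorusPotential

/-- The potential viewed as a real-valued `1`-periodic function on `ℝ`
(only used at non-integer arguments, where the potential is finite). -/
noncomputable def onReal (f : TorusPotential) (t : ℝ) : ℝ :=
  (f.toFun (t : UnitAddCircle)).toReal

/-- The tensor product potential `F(t₁, …, t_d) = f(t₁) ⋯ f(t_d)` on `𝕋^d`. -/
noncomputable def tensor (f : TorusPotential) {d : ℕ} (t : Fin d → UnitAddCircle) : ℝ≥0∞ :=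
  ∏ i, f.toFun (t i)

/-- The tensor product energy `E_F(X) = ∑_{k ≠ l} F(x^k - x^l)` of `N` points of `𝕋^d`
(repetitions among the points are allowed). -/
noncomputable def energy (f : TorusPotential) {N d : ℕ}
    (x : Fin N → Fin d → UnitAddCircle) : ℝ≥0∞ :=
  ∑ k, ∑ l ∈ Finset.univ.erase k, f.tensor (x k - x l)

/-- `x` is a global minimizer of the energy among all `N`-point configurations in `𝕋^d`. -/
def IsEnergyMinimizer (f : TorusPotential) {N d : ℕ}
    (x : Fin N → Fin d → UnitAddCircle) : Prop :=
  ∀ y : Fin N → Fin d → UnitAddCircle, f.energy x ≤ f.energy y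

end TorusPotential

/-- `g` is logarithmically convex on `s`: it is positive there and `log g` is convex on `s`. -/
def LogConvexOn (s : Set ℝ) (g : ℝ → ℝ) : Prop :=
  (∀ t ∈ s, 0 < g t) ∧ ConvexOn ℝ s (fun t => Real.log (g t))

/-- `g` is strictly logarithmically convex on `s`. -/
def StrictLogConvexOn (s : Set ℝ) (g : ℝ → ℝ) : Prop :=
  (∀ t ∈ s, 0 < g t) ∧ StrictConvexOn ℝ s (fun t => Real.log (g t))

/-- The four-point configuration `{(0,0), (a,1/2), (1/2,a), (1/2+a,1/2+a)}` in `𝕋²`. -/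
noncomputable def fourPointConfig (a : ℝ) : Fin 4 → Fin 2 → UnitAddCircle :=
  ![![((0 : ℝ) : UnitAddCircle), ((0 : ℝ) : UnitAddCircle)],
    ![(a : UnitAddCircle), ((1 / 2 : ℝ) : UnitAddCircle)],
    ![((1 / 2 : ℝ) : UnitAddCircle), (a : UnitAddCircle)],
    ![((1 / 2 + a : ℝ) : UnitAddCircle), ((1 / 2 + a : ℝ) : UnitAddCircle)]]

/-- The equation `f'(a) f(1/2) = f'(1/2 - a) f(1/2 - a)`. -/
def FourPointCondition (f : TorusPotential) (a : ℝ) : Prop :=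
  deriv f.onReal a * f.onReal (1 / 2) = deriv f.onReal (1 / 2 - a) * f.onReal (1 / 2 - a)

/-!
Write `φ(γ) = 8 f(1/2) f(γ) + 4 f(1/2 - γ)²`, the energy of the configuration with parameter `γ`
(`energy_fourPointConfig`). The heart of the proof is that every four-point configuration has
energy at least `φ(γ)` for some `γ ∈ [0, 1/2]` (`exists_fourPointEnergy_le_energy`).

The six pairs of points form three perfect matchings. In one coordinate, the four points in their
cyclic order have two diagonals, which form one matching, and four sides, which form the other two.
If the sides of one matching have total length `2α`, those of the other have total length `1 - 2α`,
so that midpoint logarithmic convexity of `f` on `[0, 1]` bounds the products of `f` over the three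
matchings from below by `f(1/2)²`, `f(α)²` and `f(1/2 - α)²` (`exists_matchingBound`). The same
holds in the other coordinate with some `β`. For each matching the inequality `2 √(u v) ≤ u + v`
joins the two coordinates, and then `f(α) f(β) ≥ f(γ)²` with `γ = (α + β) / 2`, together with the
same bound at `1/2 - α` and `1/2 - β`, gives `φ(γ)`. This works whether the diagonal matchings of
the two coordinates differ or coincide. The inequalities are proved in `[0, ∞]`, so that coinciding
points and a singularity of `f` need no separate treatment.

The continuous function `φ` attains its minimum on `[0, 1/2]`. It does so in the interior, because
`φ(0) ≤ φ(1/2)` and because `f'(1/2) = 0` while `f` decreases at least linearly at `0` unless it is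
constant (`exists_fourPointEnergy_le_zero`). An interior minimum is a critical point, which is the
condition on `a`. If `log f` is strictly convex, then `φ'` is strictly increasing, so the critical
point is unique (`fourPointCondition_unique`).
-/

open Filter Topology

/-! ### Auxiliary inequalities and logarithmic convexity -/

theorem ENNReal.two_mul_le_add_of_sq_le_mul {m p q : ℝ≥0∞} (h : m ^ 2 ≤ p * q) :
    2 * m ≤ p + q := by
  rcases eq_or_ne p ∞ with rfl | hp
  · simp
  rcases eq_or_ne q ∞ with rfl | hq
  · simp
  have hm : m ≠ ∞ := by
    rintro rfl
    exact ENNReal.mul_ne_top hp hq (top_le_iff.1 (by simpa using h))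
  lift p to NNReal using hp
  lift q to NNReal using hq
  lift m to NNReal using hm
  norm_cast at h ⊢
  rw [← NNReal.coe_le_coe] at h ⊢
  push_cast at h ⊢
  refine abs_le_of_sq_le_sq' ?_ (by positivity) |>.2
  nlinarith [sq_nonneg ((p : ℝ) - q)]

/-- To prove a permutation-invariant statement about four reals, one may assume they are sorted. -/
theorem forall_of_sorted_of_swap {R : ℝ → ℝ → ℝ → ℝ → Prop}
    (h₁ : ∀ a b c d, R a b c d → R b a c d) (h₂ : ∀ a b c d, R a b c d → R a c b d)
    (h₃ : ∀ a b c d, R a b c d → R a b d c)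
    (h : ∀ a b c d, a ≤ b → b ≤ c → c ≤ d → R a b c d) (a b c d : ℝ) : R a b c d := by
  have three : ∀ a b c d, a ≤ b → b ≤ c → R a b c d := by
    intro a b c d hab hbc
    rcases le_total c d with hcd | hcd
    · exact h _ _ _ _ hab hbc hcd
    apply h₃
    rcases le_total b d with hbd | hbd
    · exact h _ _ _ _ hab hbd hcd
    apply h₂
    rcases le_total a d with had | had
    · exact h _ _ _ _ had hbd hbc
    · exact h₁ _ _ _ _ (h _ _ _ _ had hab hbc)
  have two : ∀ a b c d, a ≤ b → R a b c d := by
    intro a b c d hab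
    rcases le_total b c with hbc | hbc
    · exact three _ _ _ _ hab hbc
    apply h₂
    rcases le_total a c with hac | hac
    · exact three _ _ _ _ hac hbc
    · exact h₁ _ _ _ _ (three _ _ _ _ hac hab)
  rcases le_total a b with hab | hab
  · exact two _ _ _ _ hab
  · exact h₁ _ _ _ _ (two _ _ _ _ hab)

theorem LogConvexOn.convexOn {s : Set ℝ} {g : ℝ → ℝ} (h : LogConvexOn s g) : ConvexOn ℝ s g := by
  refine ⟨h.2.1, fun x hx y hy a b ha hb hab => ?_⟩
  have h1 := h.2.2 hx hy ha hb hab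
  have h2 := convexOn_exp.2 (Set.mem_univ (Real.log (g x))) (Set.mem_univ (Real.log (g y)))
    ha hb hab
  rw [Real.exp_log (h.1 x hx), Real.exp_log (h.1 y hy)] at h2
  refine le_trans ?_ h2
  rw [← Real.log_le_iff_le_exp (h.1 _ (h.2.1 hx hy ha hb hab))]
  exact h1

theorem StrictLogConvexOn.strictConvexOn {s : Set ℝ} {g : ℝ → ℝ} (h : StrictLogConvexOn s g) :
    StrictConvexOn ℝ s g := by
  refine ⟨h.2.1, fun x hx y hy hxy a b ha hb hab => ?_⟩
  have h1 := h.2.2 hx hy hxy ha hb hab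
  have h2 := convexOn_exp.2 (Set.mem_univ (Real.log (g x))) (Set.mem_univ (Real.log (g y)))
    ha.le hb.le hab
  rw [Real.exp_log (h.1 x hx), Real.exp_log (h.1 y hy)] at h2
  refine lt_of_lt_of_le ?_ h2
  rw [← Real.log_lt_iff_lt_exp (h.1 _ (h.2.1 hx hy ha.le hb.le hab))]
  exact h1

theorem LogConvexOn.sq_midpoint_le {s : Set ℝ} {g : ℝ → ℝ} (h : LogConvexOn s g) {x y : ℝ}
    (hx : x ∈ s) (hy : y ∈ s) : g ((x + y) / 2) ^ 2 ≤ g x * g y := by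
  have hm : (x + y) / 2 ∈ s := by
    have := h.2.1 hx hy (by norm_num : (0 : ℝ) ≤ 1 / 2) (by norm_num : (0 : ℝ) ≤ 1 / 2) (by norm_num)
    convert this using 1
    simp only [smul_eq_mul]; ring
  have h1 := h.2.2 hx hy (by norm_num : (0 : ℝ) ≤ 1 / 2) (by norm_num : (0 : ℝ) ≤ 1 / 2)
    (by norm_num)
  simp only [smul_eq_mul] at h1
  rw [show 1 / 2 * x + 1 / 2 * y = (x + y) / 2 by ring] at h1
  rw [← Real.log_le_log_iff (by have := h.1 _ hm; positivity) (mul_pos (h.1 x hx) (h.1 y hy)),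
    Real.log_pow, Real.log_mul (h.1 x hx).ne' (h.1 y hy).ne']
  push_cast
  linarith

/-! ### The extended-valued potential and the energy of four points -/

namespace TorusPotential

variable (f : TorusPotential)

/-- The potential as an extended-valued `1`-periodic function on `ℝ`, including its value `f(0)`
at the integers. -/
noncomputable def lift (t : ℝ) : ℝ≥0∞ := f.toFun (t : UnitAddCircle)

theorem continuous_lift : Continuous f.lift :=
  f.continuous'.comp (AddCircle.continuous_mk' 1)

theorem lift_neg (t : ℝ) : f.lift (-t) = f.lift t := by
  simp [lift, f.even']

theorem lift_one_sub (t : ℝ) : f.lift (1 - t) = f.lift t := by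
  rw [← lift_neg]
  simp only [lift]
  congr 1
  rw [neg_sub, AddCircle.coe_sub]
  have : ((1 : ℝ) : UnitAddCircle) = 0 := AddCircle.coe_period 1
  rw [this, sub_zero]

theorem toReal_lift (t : ℝ) : (f.lift t).toReal = f.onReal t := rfl

theorem lift_ne_top {t : ℝ} (ht : t ∈ Set.Ioo (0 : ℝ) 1) : f.lift t ≠ ∞ := by
  apply f.finite'
  intro h
  rw [AddCircle.coe_eq_zero_iff_of_mem_Ico (p := 1) ⟨ht.1.le, by simpa using ht.2⟩] at h
  exact ht.1.ne' h

theorem ofReal_onReal {t : ℝ} (ht : t ∈ Set.Ioo (0 : ℝ) 1) :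
    ENNReal.ofReal (f.onReal t) = f.lift t := by
  rw [← toReal_lift, ENNReal.ofReal_toReal (f.lift_ne_top ht)]

/-- The energy of the configuration `fourPointConfig a`, as a function of `a`. -/
noncomputable def fourPointEnergy (a : ℝ) : ℝ≥0∞ :=
  8 * (f.lift (1 / 2) * f.lift a) + 4 * f.lift (1 / 2 - a) ^ 2

theorem continuous_fourPointEnergy : Continuous f.fourPointEnergy := by
  unfold fourPointEnergy
  have h : f.lift (1 / 2) ≠ ∞ := f.lift_ne_top (by norm_num)
  refine Continuous.add ?_ ?_
  · exact (ENNReal.continuous_const_mul (by norm_num)).comp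
      ((ENNReal.continuous_const_mul h).comp f.continuous_lift)
  · refine (ENNReal.continuous_const_mul (by norm_num)).comp
      ((ENNReal.continuous_pow 2).comp (f.continuous_lift.comp (by fun_prop)))

theorem energy_four {d : ℕ} (x : Fin 4 → Fin d → UnitAddCircle) :
    f.energy x = 2 * ((f.tensor (x 0 - x 1) + f.tensor (x 2 - x 3)) +
      (f.tensor (x 0 - x 2) + f.tensor (x 1 - x 3)) +
      (f.tensor (x 0 - x 3) + f.tensor (x 1 - x 2))) := by
  have hs : ∀ k l, f.tensor (x k - x l) = f.tensor (x l - x k) := by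
    intro k l
    refine Finset.prod_congr rfl fun i _ => ?_
    rw [← f.even', Pi.sub_apply, neg_sub, Pi.sub_apply]
  have e0 : Finset.univ.erase (0 : Fin 4) = {1, 2, 3} := by decide
  have e1 : Finset.univ.erase (1 : Fin 4) = {0, 2, 3} := by decide
  have e2 : Finset.univ.erase (2 : Fin 4) = {0, 1, 3} := by decide
  have e3 : Finset.univ.erase (3 : Fin 4) = {0, 1, 2} := by decide
  have hsum : ∀ (g : Fin 4 → ℝ≥0∞) (i j k : Fin 4), i ≠ j → i ≠ k → j ≠ k →
      ∑ l ∈ ({i, j, k} : Finset (Fin 4)), g l = g i + g j + g k := by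
    intro g i j k hij hik hjk
    rw [Finset.sum_insert (by simp [hij, hik]), Finset.sum_pair hjk, add_assoc]
  rw [energy, Fin.sum_univ_four, e0, e1, e2, e3, hsum _ _ _ _ (by decide) (by decide) (by decide),
    hsum _ _ _ _ (by decide) (by decide) (by decide),
    hsum _ _ _ _ (by decide) (by decide) (by decide),
    hsum _ _ _ _ (by decide) (by decide) (by decide), hs 1 0, hs 2 0, hs 3 0, hs 2 1, hs 3 1,
    hs 3 2]
  ring

theorem tensor_two (t : Fin 2 → UnitAddCircle) :
    f.tensor t = f.toFun (t 0) * f.toFun (t 1) := by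
  simp [tensor]

theorem energy_fourPointConfig (a : ℝ) :
    f.energy (fourPointConfig a) = f.fourPointEnergy a := by
  have h1 : ∀ s t : ℝ, f.toFun ((s : UnitAddCircle) - (t : UnitAddCircle)) = f.lift (s - t) := by
    intro s t; rw [lift, AddCircle.coe_sub]
  have e2 : ∀ a b : ℝ, a + b = 1 → f.lift (-a) = f.lift b := by
    intro a b h
    rw [lift_neg, ← lift_one_sub]; congr 1; linarith
  rw [energy_four]
  simp only [tensor_two, Pi.sub_apply, fourPointConfig, Matrix.cons_val_zero, Matrix.cons_val_one,
    Matrix.cons_val, h1]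
  rw [show 0 - (1 / 2 + a) = -(1 / 2 + a) by ring, e2 (1 / 2 + a) (1 / 2 - a) (by ring),
    show 1 / 2 - (1 / 2 + a) = -a by ring, show a - (1 / 2 + a) = -(1 / 2) by ring,
    show a - 1 / 2 = -(1 / 2 - a) by ring, show 0 - a = -a by ring,
    show (0 : ℝ) - 1 / 2 = -(1 / 2) by ring, lift_neg, lift_neg, lift_neg, fourPointEnergy]
  ring

end TorusPotential

/-! ### The lower bound for arbitrary configurations -/

namespace TorusPotential

variable {f : TorusPotential}

/-- Monotonicity extends to the endpoint `0`, where the value may be infinite. -/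
theorem antitoneOn_lift (hdecr : AntitoneOn f.onReal (Set.Ioc 0 (1 / 2))) :
    AntitoneOn f.lift (Set.Icc 0 (1 / 2)) := by
  have pos : ∀ s t : ℝ, 0 < s → s ≤ t → t ≤ 1 / 2 → f.lift t ≤ f.lift s := by
    intro s t hs hst ht
    rw [← f.ofReal_onReal ⟨hs, by linarith⟩, ← f.ofReal_onReal ⟨hs.trans_le hst, by linarith⟩]
    exact ENNReal.ofReal_le_ofReal (hdecr ⟨hs, hst.trans ht⟩ ⟨hs.trans_le hst, ht⟩ hst)
  intro s hs t ht hst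
  rcases hs.1.eq_or_lt with rfl | h0
  · rcases ht.1.eq_or_lt with rfl | h0t
    · exact le_rfl
    refine ge_of_tendsto (f.continuous_lift.continuousWithinAt (s := Set.Ioi 0) (x := 0)) ?_
    filter_upwards [Ioo_mem_nhdsGT h0t] with u hu
    exact pos u t hu.1 hu.2.le ht.2
  · exact pos s t h0 hst ht.2

theorem lift_ne_zero (hpos : ∀ t ∈ Set.Ioc (0 : ℝ) (1 / 2), 0 < f.onReal t)
    {t : ℝ} (ht : t ∈ Set.Ioc (0 : ℝ) (1 / 2)) : f.lift t ≠ 0 := by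
  intro h
  have := hpos t ht
  rw [← toReal_lift, h] at this
  simp at this

theorem sq_lift_midpoint_le_of_le_half (hconv : LogConvexOn (Set.Ioc 0 (1 / 2)) f.onReal)
    {x y : ℝ} (hx : x ∈ Set.Icc (0 : ℝ) (1 / 2)) (hy : y ∈ Set.Icc (0 : ℝ) (1 / 2)) :
    f.lift ((x + y) / 2) ^ 2 ≤ f.lift x * f.lift y := by
  have pos : ∀ s ∈ Set.Ioc (0 : ℝ) (1 / 2), ∀ t ∈ Set.Ioc (0 : ℝ) (1 / 2),
      f.lift ((s + t) / 2) ^ 2 ≤ f.lift s * f.lift t := by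
    intro s hs t ht
    rw [← f.ofReal_onReal ⟨hs.1, by linarith [hs.2]⟩, ← f.ofReal_onReal ⟨ht.1, by linarith [ht.2]⟩,
      ← f.ofReal_onReal (t := (s + t) / 2)
        ⟨by linarith [hs.1, ht.1], by linarith [hs.2, ht.2]⟩,
      ← ENNReal.ofReal_pow (by exact ENNReal.toReal_nonneg),
      ← ENNReal.ofReal_mul (by exact ENNReal.toReal_nonneg)]
    exact ENNReal.ofReal_le_ofReal (hconv.sq_midpoint_le hs ht)
  have zero : ∀ t ∈ Set.Ioc (0 : ℝ) (1 / 2), f.lift ((0 + t) / 2) ^ 2 ≤ f.lift 0 * f.lift t := by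
    intro t ht
    have hl : Tendsto (fun s => f.lift ((s + t) / 2) ^ 2) (𝓝[>] 0) (𝓝 (f.lift ((0 + t) / 2) ^ 2)) :=
      (((ENNReal.continuous_pow 2).comp
        (f.continuous_lift.comp (by fun_prop : Continuous fun s : ℝ => (s + t) / 2))).tendsto
          0).mono_left nhdsWithin_le_nhds
    have hr : Tendsto (fun s => f.lift s * f.lift t) (𝓝[>] 0) (𝓝 (f.lift 0 * f.lift t)) :=
      ENNReal.Tendsto.mul_const ((f.continuous_lift.tendsto 0).mono_left nhdsWithin_le_nhds)
        (Or.inr (f.lift_ne_top ⟨ht.1, by linarith [ht.2]⟩))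
    refine le_of_tendsto_of_tendsto hl hr ?_
    filter_upwards [Ioc_mem_nhdsGT (show (0 : ℝ) < 1 / 2 by norm_num)] with s hs
    exact pos s hs t ht
  rcases hx.1.eq_or_lt with rfl | hx0
  · rcases hy.1.eq_or_lt with rfl | hy0
    · simp [sq]
    · exact zero y ⟨hy0, hy.2⟩
  · rcases hy.1.eq_or_lt with rfl | hy0
    · rw [add_comm, mul_comm]
      exact zero x ⟨hx0, hx.2⟩
    · exact pos x ⟨hx0, hx.2⟩ y ⟨hy0, hy.2⟩

theorem lift_min (t : ℝ) : f.lift (min t (1 - t)) = f.lift t := by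
  rcases min_choice t (1 - t) with h | h <;> rw [h]
  exact f.lift_one_sub t

/-- Midpoint logarithmic convexity on all of `[0, 1]`: folding the interval at `1/2` by
`t ↦ min t (1 - t)` is concave, and `f` decreases on the folded interval. -/
theorem sq_lift_midpoint_le (hdecr : AntitoneOn f.onReal (Set.Ioc 0 (1 / 2)))
    (hconv : LogConvexOn (Set.Ioc 0 (1 / 2)) f.onReal)
    {x y : ℝ} (hx : x ∈ Set.Icc (0 : ℝ) 1) (hy : y ∈ Set.Icc (0 : ℝ) 1) :
    f.lift ((x + y) / 2) ^ 2 ≤ f.lift x * f.lift y := by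
  have fold : ∀ t ∈ Set.Icc (0 : ℝ) 1, min t (1 - t) ∈ Set.Icc (0 : ℝ) (1 / 2) := by
    intro t ht
    refine ⟨le_min ht.1 (by linarith [ht.2]), ?_⟩
    rcases le_total t (1 / 2) with h | h
    · exact (min_le_left _ _).trans h
    · exact (min_le_right _ _).trans (by linarith)
  have hm : (x + y) / 2 ∈ Set.Icc (0 : ℝ) 1 :=
    ⟨by linarith [hx.1, hy.1], by linarith [hx.2, hy.2]⟩
  have key := sq_lift_midpoint_le_of_le_half hconv (fold x hx) (fold y hy)
  rw [lift_min, lift_min] at key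
  refine le_trans ?_ key
  rw [← lift_min ((x + y) / 2)]
  refine pow_le_pow_left₀ zero_le (antitoneOn_lift hdecr ?_ (fold _ hm) ?_) 2
  · have h1 := fold x hx
    have h2 := fold y hy
    exact ⟨by linarith [h1.1, h2.1], by linarith [h1.2, h2.2]⟩
  · apply le_min
    · linarith [min_le_left x (1 - x), min_le_left y (1 - y)]
    · linarith [min_le_right x (1 - x), min_le_right y (1 - y)]

theorem lift_half_le (hdecr : AntitoneOn f.onReal (Set.Ioc 0 (1 / 2))) {t : ℝ}
    (ht : t ∈ Set.Icc (0 : ℝ) 1) : f.lift (1 / 2) ≤ f.lift t := by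
  rcases le_total t (1 / 2) with h | h
  · exact antitoneOn_lift hdecr ⟨ht.1, h⟩ ⟨by norm_num, le_rfl⟩ h
  · rw [← lift_one_sub f t]
    exact antitoneOn_lift hdecr ⟨by linarith [ht.2], by linarith⟩ ⟨by norm_num, le_rfl⟩ (by linarith)

/-- For some `α ∈ [0, 1/2]` the numbers `P`, `Q`, `R` are at least `f(1/2)²`, `f(α)²`
and `f(1/2 - α)²` respectively. With `P`, `Q`, `R` the products of `f` over the two pairs of each
of the three perfect matchings of four points on the circle, this is the bound that holds when the
matching of `P` consists of the two diagonals. -/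
def MatchingBound (f : TorusPotential) (P Q R : ℝ≥0∞) : Prop :=
  ∃ α ∈ Set.Icc (0 : ℝ) (1 / 2),
    f.lift (1 / 2) ^ 2 ≤ P ∧ f.lift α ^ 2 ≤ Q ∧ f.lift (1 / 2 - α) ^ 2 ≤ R

theorem MatchingBound.symm {P Q R : ℝ≥0∞} (h : MatchingBound f P Q R) : MatchingBound f P R Q := by
  obtain ⟨α, hα, h1, h2, h3⟩ := h
  exact ⟨1 / 2 - α, ⟨by linarith [hα.2], by linarith [hα.1]⟩, h1, h3, by simpa using h2⟩

/-- Bounds for the three matchings of four points on the circle, one of which consists of the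
diagonals. For sorted points `a ≤ b ≤ c ≤ d` this is midpoint convexity: the sum of the lengths of
two opposite sides is `2α`, that of the other two is `1 - 2α`. -/
theorem exists_matchingBound (hdecr : AntitoneOn f.onReal (Set.Ioc 0 (1 / 2)))
    (hconv : LogConvexOn (Set.Ioc 0 (1 / 2)) f.onReal) (a b c d : ℝ)
    (ha : a ∈ Set.Ico (0 : ℝ) 1) (hb : b ∈ Set.Ico (0 : ℝ) 1) (hc : c ∈ Set.Ico (0 : ℝ) 1)
    (hd : d ∈ Set.Ico (0 : ℝ) 1) :
    let P := f.lift (a - b) * f.lift (c - d)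
    let Q := f.lift (a - c) * f.lift (b - d)
    let R := f.lift (a - d) * f.lift (b - c)
    MatchingBound f P Q R ∨ MatchingBound f Q P R ∨ MatchingBound f R P Q := by
  have comm : ∀ s t : ℝ, f.lift (s - t) = f.lift (t - s) := by
    intro s t; rw [← lift_neg, neg_sub]
  revert ha hb hc hd
  refine forall_of_sorted_of_swap (R := fun a b c d =>
    a ∈ Set.Ico (0 : ℝ) 1 → b ∈ Set.Ico (0 : ℝ) 1 → c ∈ Set.Ico (0 : ℝ) 1 → d ∈ Set.Ico (0 : ℝ) 1 →
    let P := f.lift (a - b) * f.lift (c - d)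
    let Q := f.lift (a - c) * f.lift (b - d)
    let R := f.lift (a - d) * f.lift (b - c)
    MatchingBound f P Q R ∨ MatchingBound f Q P R ∨ MatchingBound f R P Q) ?_ ?_ ?_ ?_ a b c d
  · intro a b c d h hb ha hc hd
    have h := h ha hb hc hd
    dsimp only at h ⊢
    rw [comm b a, mul_comm (f.lift (b - c)), mul_comm (f.lift (b - d))]
    rcases h with h | h | h
    · exact Or.inl h.symm
    · exact Or.inr (Or.inr h)
    · exact Or.inr (Or.inl h)
  · intro a b c d h ha hc hb hd
    have h := h ha hb hc hd
    dsimp only at h ⊢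
    rw [comm c b]
    rcases h with h | h | h
    · exact Or.inr (Or.inl h)
    · exact Or.inl h
    · exact Or.inr (Or.inr h.symm)
  · intro a b c d h ha hb hd hc
    have h := h ha hb hc hd
    dsimp only at h ⊢
    rw [comm d c]
    rcases h with h | h | h
    · exact Or.inl h.symm
    · exact Or.inr (Or.inr h)
    · exact Or.inr (Or.inl h)
  · intro a b c d hab hbc hcd ha hb hc hd
    refine Or.inr (Or.inl ⟨(b - a + (d - c)) / 2, ⟨by linarith, by linarith [ha.1, hd.2]⟩, ?_, ?_, ?_⟩)
    · rw [comm a c, comm b d, sq]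
      exact mul_le_mul' (lift_half_le hdecr ⟨by linarith, by linarith [ha.1, hc.2]⟩)
        (lift_half_le hdecr ⟨by linarith, by linarith [hb.1, hd.2]⟩)
    · rw [comm a b, comm c d]
      exact sq_lift_midpoint_le hdecr hconv ⟨by linarith, by linarith [ha.1, hb.2]⟩
        ⟨by linarith, by linarith [hc.1, hd.2]⟩
    · rw [comm a d, comm b c, ← lift_one_sub f (d - a),
        show 1 / 2 - (b - a + (d - c)) / 2 = (1 - (d - a) + (c - b)) / 2 by ring]
      exact sq_lift_midpoint_le hdecr hconv ⟨by linarith [ha.1, hd.2], by linarith⟩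
        ⟨by linarith, by linarith [hb.1, hc.2]⟩

/-- Case in which the same matching is diagonal in both coordinates. -/
theorem exists_fourPointEnergy_le_of_same
    (hconv : LogConvexOn (Set.Ioc 0 (1 / 2)) f.onReal) {P Q R P' Q' R' S T U : ℝ≥0∞}
    (h : MatchingBound f P Q R) (h' : MatchingBound f P' Q' R')
    (hS : ∀ m m', m ^ 2 ≤ P → m' ^ 2 ≤ P' → 2 * (m * m') ≤ S)
    (hT : ∀ m m', m ^ 2 ≤ Q → m' ^ 2 ≤ Q' → 2 * (m * m') ≤ T)
    (hU : ∀ m m', m ^ 2 ≤ R → m' ^ 2 ≤ R' → 2 * (m * m') ≤ U) :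
    ∃ γ ∈ Set.Icc (0 : ℝ) (1 / 2), f.fourPointEnergy γ ≤ 2 * (S + T + U) := by
  obtain ⟨α, hα, h1, h2, h3⟩ := h
  obtain ⟨β, hβ, h1', h2', h3'⟩ := h'
  refine ⟨(α + β) / 2, ⟨by linarith [hα.1, hβ.1], by linarith [hα.2, hβ.2]⟩, ?_⟩
  have k1 : f.lift ((α + β) / 2) ^ 2 ≤ f.lift α * f.lift β :=
    sq_lift_midpoint_le_of_le_half hconv hα hβ
  have k2 : f.lift (1 / 2 - (α + β) / 2) ^ 2 ≤ f.lift (1 / 2 - α) * f.lift (1 / 2 - β) := by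
    rw [show 1 / 2 - (α + β) / 2 = ((1 / 2 - α) + (1 / 2 - β)) / 2 by ring]
    exact sq_lift_midpoint_le_of_le_half hconv ⟨by linarith [hα.2], by linarith [hα.1]⟩
      ⟨by linarith [hβ.2], by linarith [hβ.1]⟩
  have k3 : 2 * (f.lift (1 / 2) * f.lift ((α + β) / 2)) ≤
      f.lift (1 / 2) ^ 2 + f.lift ((α + β) / 2) ^ 2 :=
    ENNReal.two_mul_le_add_of_sq_le_mul (by rw [mul_pow])
  calc f.fourPointEnergy ((α + β) / 2)
      = 4 * (2 * (f.lift (1 / 2) * f.lift ((α + β) / 2))) +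
        4 * f.lift (1 / 2 - (α + β) / 2) ^ 2 := by unfold fourPointEnergy; ring
    _ ≤ 4 * (f.lift (1 / 2) ^ 2 + f.lift α * f.lift β) +
        4 * (f.lift (1 / 2 - α) * f.lift (1 / 2 - β)) := by
      gcongr
      exact k3.trans (by gcongr)
    _ = 2 * (2 * (f.lift (1 / 2) * f.lift (1 / 2)) + 2 * (f.lift α * f.lift β) +
        2 * (f.lift (1 / 2 - α) * f.lift (1 / 2 - β))) := by ring
    _ ≤ 2 * (S + T + U) := by
      gcongr
      exacts [hS _ _ h1 h1', hT _ _ h2 h2', hU _ _ h3 h3']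

/-- Case in which different matchings are diagonal in the two coordinates; this is the case of the
configurations `fourPointConfig a`. -/
theorem exists_fourPointEnergy_le_of_ne
    (hconv : LogConvexOn (Set.Ioc 0 (1 / 2)) f.onReal) {P Q R P' Q' R' S T U : ℝ≥0∞}
    (h : MatchingBound f P Q R) (h' : MatchingBound f Q' P' R')
    (hS : ∀ m m', m ^ 2 ≤ P → m' ^ 2 ≤ P' → 2 * (m * m') ≤ S)
    (hT : ∀ m m', m ^ 2 ≤ Q → m' ^ 2 ≤ Q' → 2 * (m * m') ≤ T)
    (hU : ∀ m m', m ^ 2 ≤ R → m' ^ 2 ≤ R' → 2 * (m * m') ≤ U) :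
    ∃ γ ∈ Set.Icc (0 : ℝ) (1 / 2), f.fourPointEnergy γ ≤ 2 * (S + T + U) := by
  obtain ⟨α, hα, h1, h2, h3⟩ := h
  obtain ⟨β, hβ, h1', h2', h3'⟩ := h'
  refine ⟨(α + β) / 2, ⟨by linarith [hα.1, hβ.1], by linarith [hα.2, hβ.2]⟩, ?_⟩
  have k1 : 2 * f.lift ((α + β) / 2) ≤ f.lift α + f.lift β :=
    ENNReal.two_mul_le_add_of_sq_le_mul (sq_lift_midpoint_le_of_le_half hconv hα hβ)
  have k2 : f.lift (1 / 2 - (α + β) / 2) ^ 2 ≤ f.lift (1 / 2 - α) * f.lift (1 / 2 - β) := by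
    rw [show 1 / 2 - (α + β) / 2 = ((1 / 2 - α) + (1 / 2 - β)) / 2 by ring]
    exact sq_lift_midpoint_le_of_le_half hconv ⟨by linarith [hα.2], by linarith [hα.1]⟩
      ⟨by linarith [hβ.2], by linarith [hβ.1]⟩
  calc f.fourPointEnergy ((α + β) / 2)
      = 4 * (f.lift (1 / 2) * (2 * f.lift ((α + β) / 2))) +
        4 * f.lift (1 / 2 - (α + β) / 2) ^ 2 := by unfold fourPointEnergy; ring
    _ ≤ 4 * (f.lift (1 / 2) * (f.lift α + f.lift β)) +
        4 * (f.lift (1 / 2 - α) * f.lift (1 / 2 - β)) := by gcongr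
    _ = 2 * (2 * (f.lift (1 / 2) * f.lift β) + 2 * (f.lift α * f.lift (1 / 2)) +
        2 * (f.lift (1 / 2 - α) * f.lift (1 / 2 - β))) := by ring
    _ ≤ 2 * (S + T + U) := by
      gcongr
      exacts [hS _ _ h1 h2', hT _ _ h2 h1', hU _ _ h3 h3']

/-- Every four-point configuration has energy at least that of some `fourPointConfig γ`, where
`γ` may still be an endpoint of `[0, 1/2]`. -/
theorem exists_fourPointEnergy_le_energy (hdecr : AntitoneOn f.onReal (Set.Ioc 0 (1 / 2)))
    (hconv : LogConvexOn (Set.Ioc 0 (1 / 2)) f.onReal) (x : Fin 4 → Fin 2 → UnitAddCircle) :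
    ∃ γ ∈ Set.Icc (0 : ℝ) (1 / 2), f.fourPointEnergy γ ≤ f.energy x := by
  have repr : ∀ z : UnitAddCircle, ∃ t ∈ Set.Ico (0 : ℝ) 1, (t : UnitAddCircle) = z := by
    intro z
    obtain ⟨t, ht, h⟩ := AddCircle.coe_image_Ico_eq (p := (1 : ℝ)) 0 ▸ Set.mem_univ z
    exact ⟨t, by simpa using ht, h⟩
  choose t ht hx using fun k i => repr (x k i)
  have amgm : ∀ p q r s m m' : ℝ≥0∞, m ^ 2 ≤ p * q → m' ^ 2 ≤ r * s →
      2 * (m * m') ≤ p * r + q * s := by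
    intro p q r s m m' h h'
    apply ENNReal.two_mul_le_add_of_sq_le_mul
    calc (m * m') ^ 2 = m ^ 2 * m' ^ 2 := mul_pow _ _ _
      _ ≤ (p * q) * (r * s) := mul_le_mul' h h'
      _ = p * r * (q * s) := by ring
  have hF : ∀ k l, f.tensor (x k - x l) = f.lift (t k 0 - t l 0) * f.lift (t k 1 - t l 1) := by
    intro k l
    simp only [tensor_two, Pi.sub_apply, lift, AddCircle.coe_sub, hx]
  have h0 := exists_matchingBound hdecr hconv (t 0 0) (t 1 0) (t 2 0) (t 3 0)
    (ht _ _) (ht _ _) (ht _ _) (ht _ _)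
  have h1 := exists_matchingBound hdecr hconv (t 0 1) (t 1 1) (t 2 1) (t 3 1)
    (ht _ _) (ht _ _) (ht _ _) (ht _ _)
  rw [energy_four]
  simp only [hF]
  dsimp only at h0 h1
  have S := amgm (f.lift (t 0 0 - t 1 0)) (f.lift (t 2 0 - t 3 0))
    (f.lift (t 0 1 - t 1 1)) (f.lift (t 2 1 - t 3 1))
  have T := amgm (f.lift (t 0 0 - t 2 0)) (f.lift (t 1 0 - t 3 0))
    (f.lift (t 0 1 - t 2 1)) (f.lift (t 1 1 - t 3 1))
  have U := amgm (f.lift (t 0 0 - t 3 0)) (f.lift (t 1 0 - t 2 0))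
    (f.lift (t 0 1 - t 3 1)) (f.lift (t 1 1 - t 2 1))
  generalize f.lift (t 0 0 - t 1 0) * f.lift (t 0 1 - t 1 1) +
    f.lift (t 2 0 - t 3 0) * f.lift (t 2 1 - t 3 1) = S₀ at S ⊢
  generalize f.lift (t 0 0 - t 2 0) * f.lift (t 0 1 - t 2 1) +
    f.lift (t 1 0 - t 3 0) * f.lift (t 1 1 - t 3 1) = T₀ at T ⊢
  generalize f.lift (t 0 0 - t 3 0) * f.lift (t 0 1 - t 3 1) +
    f.lift (t 1 0 - t 2 0) * f.lift (t 1 1 - t 2 1) = U₀ at U ⊢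
  -- The three terms of the sum, in the order that puts the diagonal matchings first.
  have p₁ : S₀ + T₀ + U₀ = T₀ + S₀ + U₀ := by ring
  have p₂ : S₀ + T₀ + U₀ = U₀ + S₀ + T₀ := by ring
  have p₃ : S₀ + T₀ + U₀ = S₀ + U₀ + T₀ := by ring
  have p₄ : S₀ + T₀ + U₀ = T₀ + U₀ + S₀ := by ring
  have p₅ : S₀ + T₀ + U₀ = U₀ + T₀ + S₀ := by ring
  rcases h0 with h0 | h0 | h0 <;> rcases h1 with h1 | h1 | h1
  · exact exists_fourPointEnergy_le_of_same hconv h0 h1 S T U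
  · exact exists_fourPointEnergy_le_of_ne hconv h0 h1 S T U
  · rw [p₃]; exact exists_fourPointEnergy_le_of_ne hconv h0.symm h1 S U T
  · rw [p₁]; exact exists_fourPointEnergy_le_of_ne hconv h0 h1 T S U
  · rw [p₁]; exact exists_fourPointEnergy_le_of_same hconv h0 h1 T S U
  · rw [p₄]; exact exists_fourPointEnergy_le_of_ne hconv h0.symm h1.symm T U S
  · rw [p₂]; exact exists_fourPointEnergy_le_of_ne hconv h0 h1.symm U S T
  · rw [p₅]; exact exists_fourPointEnergy_le_of_ne hconv h0.symm h1.symm U T S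
  · rw [p₂]; exact exists_fourPointEnergy_le_of_same hconv h0 h1 U S T

end TorusPotential

/-! ### Minimizing over the family of configurations -/

namespace TorusPotential

variable {f : TorusPotential}

theorem hasDerivAt_onReal (hdiff : DifferentiableOn ℝ f.onReal (Set.Ioo 0 1)) {t : ℝ}
    (ht : t ∈ Set.Ioo (0 : ℝ) 1) : HasDerivAt f.onReal (deriv f.onReal t) t :=
  (hdiff.differentiableAt (isOpen_Ioo.mem_nhds ht)).hasDerivAt

theorem onReal_one_sub (t : ℝ) : f.onReal (1 - t) = f.onReal t := by
  rw [← toReal_lift, ← toReal_lift, lift_one_sub]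

/-- The potential is symmetric about `1/2` and smallest there. -/
theorem deriv_onReal_half (hdecr : AntitoneOn f.onReal (Set.Ioc 0 (1 / 2))) :
    deriv f.onReal (1 / 2) = 0 := by
  apply IsLocalMin.deriv_eq_zero
  filter_upwards [Ioo_mem_nhds (show (0 : ℝ) < 1 / 2 by norm_num)
    (show (1 / 2 : ℝ) < 1 by norm_num)] with t ht
  exact (ENNReal.toReal_le_toReal (f.lift_ne_top (by norm_num)) (f.lift_ne_top ht)).2
    (lift_half_le hdecr ⟨ht.1.le, ht.2.le⟩)

theorem fourPointEnergy_eq_ofReal {a : ℝ} (ha : a ∈ Set.Ioo (0 : ℝ) (1 / 2)) :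
    f.fourPointEnergy a = ENNReal.ofReal
      (8 * (f.onReal (1 / 2) * f.onReal a) + 4 * f.onReal (1 / 2 - a) ^ 2) := by
  have nn : ∀ t, 0 ≤ f.onReal t := fun t => ENNReal.toReal_nonneg
  rw [fourPointEnergy, ← f.ofReal_onReal ⟨ha.1, by linarith [ha.2]⟩,
    ← f.ofReal_onReal (t := 1 / 2) (by norm_num),
    ← f.ofReal_onReal (t := 1 / 2 - a) ⟨by linarith [ha.2], by linarith [ha.1]⟩,
    ← ENNReal.ofReal_mul (nn _), ← ENNReal.ofReal_pow (nn _),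
    show (8 : ℝ≥0∞) = ENNReal.ofReal 8 by simp, show (4 : ℝ≥0∞) = ENNReal.ofReal 4 by simp,
    ← ENNReal.ofReal_mul (by norm_num), ← ENNReal.ofReal_mul (by norm_num), ← ENNReal.ofReal_add]
  · have := mul_nonneg (nn (1 / 2)) (nn a)
    positivity
  · positivity

theorem hasDerivAt_fourPointEnergy (hdiff : DifferentiableOn ℝ f.onReal (Set.Ioo 0 1)) {a : ℝ}
    (ha : a ∈ Set.Ioo (0 : ℝ) (1 / 2)) :
    HasDerivAt (fun a => 8 * (f.onReal (1 / 2) * f.onReal a) + 4 * f.onReal (1 / 2 - a) ^ 2)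
      (8 * (deriv f.onReal a * f.onReal (1 / 2) -
        deriv f.onReal (1 / 2 - a) * f.onReal (1 / 2 - a))) a := by
  have h1 := hasDerivAt_onReal hdiff (t := a) ⟨ha.1, by linarith [ha.2]⟩
  have h2 := hasDerivAt_onReal hdiff (t := 1 / 2 - a) ⟨by linarith [ha.2], by linarith [ha.1]⟩
  have h3 := h2.comp a ((hasDerivAt_id a).const_sub (1 / 2))
  refine (((h1.const_mul (f.onReal (1 / 2))).const_mul 8).add
    ((h3.pow 2).const_mul 4)).congr_deriv ?_
  simp only [Function.comp]
  push_cast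
  ring

theorem fourPointCondition_of_forall_le (hdiff : DifferentiableOn ℝ f.onReal (Set.Ioo 0 1))
    {a : ℝ} (ha : a ∈ Set.Ioo (0 : ℝ) (1 / 2))
    (hmin : ∀ b ∈ Set.Ioo (0 : ℝ) (1 / 2), f.fourPointEnergy a ≤ f.fourPointEnergy b) :
    FourPointCondition f a := by
  have hloc : IsLocalMin
      (fun a => 8 * (f.onReal (1 / 2) * f.onReal a) + 4 * f.onReal (1 / 2 - a) ^ 2) a := by
    filter_upwards [Ioo_mem_nhds ha.1 ha.2] with b hb
    have h := hmin b hb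
    rw [fourPointEnergy_eq_ofReal ha, fourPointEnergy_eq_ofReal hb] at h
    refine (ENNReal.ofReal_le_ofReal_iff ?_).1 h
    have := mul_nonneg (ENNReal.toReal_nonneg : 0 ≤ f.onReal (1 / 2))
      (ENNReal.toReal_nonneg : 0 ≤ f.onReal b)
    positivity
  have := hloc.hasDerivAt_eq_zero (hasDerivAt_fourPointEnergy hdiff ha)
  unfold FourPointCondition
  linarith

/-- Under strict convexity the left side of the condition increases strictly in `a`, while the
right side, half the derivative of the convex function `f²` at `1/2 - a`, decreases. -/
theorem fourPointCondition_unique (hdiff : DifferentiableOn ℝ f.onReal (Set.Ioo 0 1))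
    (hconv : StrictLogConvexOn (Set.Ioc 0 (1 / 2)) f.onReal) {a b : ℝ}
    (ha : a ∈ Set.Ioo (0 : ℝ) (1 / 2)) (hb : b ∈ Set.Ioo (0 : ℝ) (1 / 2))
    (hfa : FourPointCondition f a) (hfb : FourPointCondition f b) : a = b := by
  have hd : ∀ t ∈ Set.Ioo (0 : ℝ) (1 / 2), HasDerivAt f.onReal (deriv f.onReal t) t :=
    fun t ht => hasDerivAt_onReal hdiff ⟨ht.1, by linarith [ht.2]⟩
  have hs : StrictConvexOn ℝ (Set.Ioo 0 (1 / 2)) f.onReal :=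
    hconv.strictConvexOn.subset Set.Ioo_subset_Ioc_self (convex_Ioo _ _)
  have h1 : StrictMonoOn (deriv f.onReal) (Set.Ioo 0 (1 / 2)) :=
    hs.strictMonoOn_deriv fun t ht => (hd t ht).differentiableAt
  have hsq : ConvexOn ℝ (Set.Ioo 0 (1 / 2)) (f.onReal ^ 2) :=
    hs.convexOn.pow (fun t _ => ENNReal.toReal_nonneg) 2
  have h2 : MonotoneOn (deriv (f.onReal ^ 2)) (Set.Ioo 0 (1 / 2)) :=
    hsq.monotoneOn_deriv fun t ht => ((hd t ht).pow 2).differentiableAt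
  have key : ∀ a b : ℝ, a ∈ Set.Ioo (0 : ℝ) (1 / 2) → b ∈ Set.Ioo (0 : ℝ) (1 / 2) →
      FourPointCondition f a → FourPointCondition f b → ¬ a < b := by
    intro a b ha hb hfa hfb hab
    have ha' : 1 / 2 - a ∈ Set.Ioo (0 : ℝ) (1 / 2) := ⟨by linarith [ha.2], by linarith [ha.1]⟩
    have hb' : 1 / 2 - b ∈ Set.Ioo (0 : ℝ) (1 / 2) := ⟨by linarith [hb.2], by linarith [hb.1]⟩
    have k1 := mul_lt_mul_of_pos_right (h1 ha hb hab) (hconv.1 (1 / 2) (by norm_num))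
    have k2 := h2 hb' ha' (by linarith)
    rw [((hd _ ha').pow 2).deriv, ((hd _ hb').pow 2).deriv] at k2
    norm_num at k2
    unfold FourPointCondition at hfa hfb
    norm_num at k1 hfa hfb
    nlinarith
  rcases lt_trichotomy a b with h | h | h
  · exact (key a b ha hb hfa hfb h).elim
  · exact h
  · exact (key b a hb ha hfb hfa h).elim

/-- The parameter `1/2` is no better than the parameter `0`. -/
theorem fourPointEnergy_zero_le_half : f.fourPointEnergy 0 ≤ f.fourPointEnergy (1 / 2) := by
  have h : 2 * (f.lift (1 / 2) * f.lift 0) ≤ f.lift (1 / 2) ^ 2 + f.lift 0 ^ 2 :=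
    ENNReal.two_mul_le_add_of_sq_le_mul (by rw [mul_pow])
  calc f.fourPointEnergy 0
      = 4 * (2 * (f.lift (1 / 2) * f.lift 0)) + 4 * f.lift (1 / 2) ^ 2 := by
        rw [fourPointEnergy, sub_zero]; ring
    _ ≤ 4 * (f.lift (1 / 2) ^ 2 + f.lift 0 ^ 2) + 4 * f.lift (1 / 2) ^ 2 := by gcongr
    _ = f.fourPointEnergy (1 / 2) := by rw [fourPointEnergy, sub_self]; ring

/-- The parameter `0` is never strictly better than all interior ones. If `f(0)` is finite and `f`
is not constant, then `f(0) - f(a)` is at least linear in `a` by convexity, while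
`f(1/2 - a)² - f(1/2)² = o(a)` since `f'(1/2) = 0`. -/
theorem exists_fourPointEnergy_le_zero (hdiff : DifferentiableOn ℝ f.onReal (Set.Ioo 0 1))
    (hdecr : AntitoneOn f.onReal (Set.Ioc 0 (1 / 2)))
    (hconv : LogConvexOn (Set.Ioc 0 (1 / 2)) f.onReal) :
    ∃ a ∈ Set.Ioo (0 : ℝ) (1 / 2), f.fourPointEnergy a ≤ f.fourPointEnergy 0 := by
  have hB : 0 < f.onReal (1 / 2) := hconv.1 _ (by norm_num)
  have hhalf : f.lift (1 / 2) ≠ 0 := lift_ne_zero hconv.1 (by norm_num)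
  by_cases htop : f.lift 0 = ∞
  · refine ⟨1 / 4, by norm_num, ?_⟩
    rw [fourPointEnergy.eq_def f 0, htop, ENNReal.mul_top hhalf]
    simp
  have hA0 : 0 ≤ f.onReal 0 := ENNReal.toReal_nonneg
  have hzero : f.fourPointEnergy 0 = ENNReal.ofReal
      (8 * (f.onReal (1 / 2) * f.onReal 0) + 4 * f.onReal (1 / 2) ^ 2) := by
    rw [ENNReal.ofReal_add (by positivity) (by positivity),
      ENNReal.ofReal_mul (by norm_num), ENNReal.ofReal_mul hB.le,
      ENNReal.ofReal_mul (by norm_num), ENNReal.ofReal_pow hB.le, f.ofReal_onReal (by norm_num),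
      ← toReal_lift f 0, ENNReal.ofReal_toReal htop, fourPointEnergy, sub_zero]
    simp
  have hA : ∀ t ∈ Set.Ioc (0 : ℝ) (1 / 2), f.onReal t ≤ f.onReal 0 := fun t ht =>
    ENNReal.toReal_mono htop (antitoneOn_lift hdecr ⟨le_rfl, by norm_num⟩ ⟨ht.1.le, ht.2⟩ ht.1.le)
  -- It suffices to compare real values.
  suffices h : ∃ a ∈ Set.Ioo (0 : ℝ) (1 / 2),
      4 * (f.onReal (1 / 2 - a) ^ 2 - f.onReal (1 / 2) ^ 2) ≤
        8 * (f.onReal (1 / 2) * (f.onReal 0 - f.onReal a)) by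
    obtain ⟨a, ha, h⟩ := h
    refine ⟨a, ha, ?_⟩
    rw [fourPointEnergy_eq_ofReal ha, hzero]
    exact ENNReal.ofReal_le_ofReal (by linarith)
  by_cases hs : ∃ s ∈ Set.Ioo (0 : ℝ) (1 / 2), f.onReal (1 / 2) < f.onReal s
  · obtain ⟨s, hs, hsB⟩ := hs
    have hcv := hconv.convexOn
    -- The slope of the chord over `[s, 1/2]` controls the decay of `f` near `0`.
    set c := (f.onReal s - f.onReal (1 / 2)) / (1 / 2 - s) with hc
    have hcpos : 0 < c := div_pos (by linarith) (by linarith [hs.2])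
    have hlin : ∀ a ∈ Set.Ioo (0 : ℝ) s, c * (a / 2) ≤ f.onReal 0 - f.onReal a := by
      intro a ha
      have k1 := hcv.slope_mono_adjacent (x := a / 2) (y := a) (z := s)
        ⟨by linarith [ha.1], by linarith [ha.1, ha.2, hs.2]⟩ ⟨hs.1, hs.2.le⟩
        (by linarith [ha.1]) ha.2
      have k2 := hcv.slope_mono_adjacent (x := a) (y := s) (z := 1 / 2)
        ⟨ha.1, by linarith [ha.1, ha.2, hs.2]⟩ (by norm_num) ha.2 hs.2
      have k3 := k1.trans k2
      rw [show (f.onReal (1 / 2) - f.onReal s) / (1 / 2 - s) = -c by rw [hc]; ring,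
        div_le_iff₀ (by linarith [ha.1])] at k3
      have k4 := hA (a / 2) ⟨by linarith [ha.1], by linarith [ha.1, ha.2, hs.2]⟩
      nlinarith
    have hder : HasDerivAt (fun a : ℝ => f.onReal (1 / 2 - a) ^ 2) 0 0 := by
      have h0 := hasDerivAt_onReal hdiff (t := 1 / 2 - 0) (by norm_num)
      have h1 := (h0.comp 0 ((hasDerivAt_id (0 : ℝ)).const_sub (1 / 2))).pow 2
      refine h1.congr_deriv ?_
      rw [sub_zero, deriv_onReal_half hdecr]
      simp
    have hsmall := (hasDerivAt_iff_isLittleO_nhds_zero.1 hder).def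
      (show 0 < f.onReal (1 / 2) * c by positivity)
    have hev := (hsmall.filter_mono (nhdsWithin_le_nhds (s := Set.Ioi 0))).and
      (Ioo_mem_nhdsGT hs.1)
    obtain ⟨a, h1, h2⟩ := hev.exists
    refine ⟨a, ⟨h2.1, h2.2.trans hs.2⟩, ?_⟩
    have h3 := le_of_abs_le h1
    simp only [zero_add, sub_zero, smul_zero, Real.norm_eq_abs, abs_of_pos h2.1] at h3
    have h4 := mul_le_mul_of_nonneg_left (hlin a h2) hB.le
    nlinarith
  · push Not at hs
    refine ⟨1 / 4, by norm_num, ?_⟩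
    have h1 := hs (1 / 2 - 1 / 4) (by norm_num)
    have h2 := hA (1 / 4) (by norm_num)
    have h3 : 0 ≤ f.onReal (1 / 2 - 1 / 4) := ENNReal.toReal_nonneg
    have h4 := pow_le_pow_left₀ h3 h1 2
    have h5 := mul_nonneg hB.le (sub_nonneg.2 h2)
    linarith

theorem exists_isEnergyMinimizer_fourPointConfig
    (hdiff : DifferentiableOn ℝ f.onReal (Set.Ioo 0 1))
    (hdecr : AntitoneOn f.onReal (Set.Ioc 0 (1 / 2)))
    (hconv : LogConvexOn (Set.Ioc 0 (1 / 2)) f.onReal) :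
    ∃ a ∈ Set.Ioo (0 : ℝ) (1 / 2), f.IsEnergyMinimizer (fourPointConfig a) := by
  obtain ⟨γ, hγ, hmin⟩ := (isCompact_Icc (a := (0 : ℝ)) (b := 1 / 2)).exists_isMinOn
    ⟨0, by norm_num⟩ f.continuous_fourPointEnergy.continuousOn
  have hint : ∃ a ∈ Set.Ioo (0 : ℝ) (1 / 2), f.fourPointEnergy a ≤ f.fourPointEnergy γ := by
    obtain ⟨a, ha, h⟩ := exists_fourPointEnergy_le_zero hdiff hdecr hconv
    rcases hγ.1.eq_or_lt with rfl | h0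
    · exact ⟨a, ha, h⟩
    rcases hγ.2.eq_or_lt with rfl | h1
    · exact ⟨a, ha, h.trans fourPointEnergy_zero_le_half⟩
    · exact ⟨γ, ⟨h0, h1⟩, le_rfl⟩
  obtain ⟨a, ha, h⟩ := hint
  refine ⟨a, ha, fun y => ?_⟩
  obtain ⟨δ, hδ, hy⟩ := exists_fourPointEnergy_le_energy hdecr hconv y
  rw [energy_fourPointConfig]
  exact (h.trans (hmin hδ)).trans hy

end TorusPotential

theorem mainTheorem7 (f : TorusPotential)
    (hdiff : DifferentiableOn ℝ f.onReal (Set.Ioo 0 1))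
    (hdecr : AntitoneOn f.onReal (Set.Ioc 0 (1 / 2)))
    (hconv : LogConvexOn (Set.Ioc 0 (1 / 2)) f.onReal) :
    (∃ a ∈ Set.Ioo (0 : ℝ) (1 / 2), f.IsEnergyMinimizer (fourPointConfig a)) ∧
    (∀ a ∈ Set.Ioo (0 : ℝ) (1 / 2),
      f.IsEnergyMinimizer (fourPointConfig a) → FourPointCondition f a) ∧
    (StrictLogConvexOn (Set.Ioc 0 (1 / 2)) f.onReal →
      (∃! a : ℝ, a ∈ Set.Ioo (0 : ℝ) (1 / 2) ∧ f.IsEnergyMinimizer (fourPointConfig a)) ∧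
      (∃! a : ℝ, a ∈ Set.Ioo (0 : ℝ) (1 / 2) ∧ FourPointCondition f a)) := by
  have hcrit : ∀ a ∈ Set.Ioo (0 : ℝ) (1 / 2),
      f.IsEnergyMinimizer (fourPointConfig a) → FourPointCondition f a := by
    intro a ha hmin
    refine TorusPotential.fourPointCondition_of_forall_le hdiff ha fun b _ => ?_
    rw [← f.energy_fourPointConfig, ← f.energy_fourPointConfig]
    exact hmin _
  obtain ⟨a, ha, hmin⟩ :=
    TorusPotential.exists_isEnergyMinimizer_fourPointConfig hdiff hdecr hconv
  refine ⟨⟨a, ha, hmin⟩, hcrit, fun hstrict => ⟨⟨a, ⟨ha, hmin⟩, ?_⟩, ⟨a, ⟨ha, hcrit a ha hmin⟩, ?_⟩⟩⟩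
  · rintro b ⟨hb, hbmin⟩
    exact TorusPotential.fourPointCondition_unique hdiff hstrict hb ha (hcrit b hb hbmin) (hcrit a ha hmin)
  · rintro b ⟨hb, hfb⟩
    exact TorusPotential.fourPointCondition_unique hdiff hstrict hb ha hfb (hcrit a ha hmin)
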